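/- Let $d\in\mathbb N$ and let $\mathcal S_d$ be the set of density matrices, i.e. positive semidefinite matrices $\rho\in\mathcal M_d=\mathbb C^{d\times d}$ with $\operatorname{tr}\rho=1$. For $\alpha\in[0,1]$ and $\rho,\sigma\in\mathcal S_d$ put $$\chi^2_\alpha(\rho,\sigma)=\operatorname{tr}\bigl[(\rho-\sigma)\,\sigma^{-\alpha}(\rho-\sigma)\,\sigma^{\alpha-1}\bigr]$$ if $\operatorname{supp}\rho\subseteq\operatorname{supp}\sigma$ (powers of $\sigma$ being taken on its support), and $\chi^2_\alpha(\rho,\sigma)=+\infty$ otherwise. Here the support of a Hermitian matrix is its range. Then for every $\alpha\in[0,1]$: 1. $\chi^2_\alpha$ is jointly convex: for all $\rho_1,\rho_2,\sigma_1,\sigma_2\in\mathcal S_d$ and all $a,b\ge 0$ with $a+b=1$, $$\chi^2_\alpha(a\rho_1+b\rho_2,\;a\sigma_1+b\sigma_2)\le a\,\chi^2_\alpha(\rho_1,\sigma_1)+b\,\chi^2_\alpha(\rho_2,\sigma_2)$$ (with $0\cdot\infty=0$). 2. $\chi^2_\alpha$ is monotone under quantum channels: for every completely positive trace-preserving linear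 map $T:\mathcal M_d\to\mathcal M_d$ and all $\rho,\sigma\in\mathcal S_d$, $$\chi^2_\alpha\bigl(T(\rho),T(\sigma)\bigr)\le\chi^2_\alpha(\rho,\sigma).$$ -/

import Mathlib

open scoped ComplexOrder in
/-- The density matrices: positive semidefinite complex `d × d` matrices of trace one. -/
def densityMatrices (d : ℕ) : Set (Matrix (Fin d) (Fin d) ℂ) :=
  {ρ | ρ.PosSemidef ∧ ρ.trace = 1}

/-- The support of a Hermitian matrix: the span of the eigenvectors with nonzero eigenvalue,
which is the range of the matrix as an operator on `ℂ^d`. -/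
def matrixSupport {d : ℕ} (A : Matrix (Fin d) (Fin d) ℂ) : Submodule ℂ (Fin d → ℂ) :=
  LinearMap.range A.mulVecLin

open scoped MatrixOrder in
/-- The trace `tr[(ρ - σ) σ^{-α} (ρ - σ) σ^{α-1}]`. For positive semidefinite `σ` the real power
`CFC.rpow σ s` applies `x ↦ x ^ s` to the eigenvalues; as `0 ^ s = 0` for `s ≠ 0`, negative powers
are taken on the support of `σ` and vanish on its kernel. (The power `s = 0` gives the identity
instead of the support projection; this makes no difference to the trace when
`supp ρ ⊆ supp σ`.) -/
noncomputable def chiSqTrace {d : ℕ} (α : ℝ) (ρ σ : Matrix (Fin d) (Fin d) ℂ) : ℂ :=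
  ((ρ - σ) * CFC.rpow σ (-α) * (ρ - σ) * CFC.rpow σ (α - 1)).trace

open scoped MatrixOrder in
/-- The trace is a real number, so that nothing is lost by taking its real part below. -/
theorem chiSqTrace_im {d : ℕ} (α : ℝ) {ρ σ : Matrix (Fin d) (Fin d) ℂ}
    (hρ : ρ.IsHermitian) (hσ : σ.IsHermitian) : (chiSqTrace α ρ σ).im = 0 := by
  have h (s : ℝ) : (CFC.rpow σ s).conjTranspose = CFC.rpow σ s :=
    (IsSelfAdjoint.of_nonneg (CFC.rpow_nonneg (a := σ) (y := s))).star_eq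
  have hd : (ρ - σ).conjTranspose = ρ - σ := hρ.sub hσ
  rw [← Complex.conj_eq_iff_im, ← RCLike.star_def, chiSqTrace, ← Matrix.trace_conjTranspose]
  simp only [Matrix.conjTranspose_mul, h, hd]
  rw [Matrix.trace_mul_comm]
  simp only [Matrix.mul_assoc]

open Classical in
/-- The divergence `χ²_α(ρ, σ)`: the trace above if `supp ρ ⊆ supp σ`, and `+∞` otherwise. -/
noncomputable def chiSq {d : ℕ} (α : ℝ) (ρ σ : Matrix (Fin d) (Fin d) ℂ) : EReal :=
  if matrixSupport ρ ≤ matrixSupport σ then (((chiSqTrace α ρ σ).re : ℝ) : EReal) else ⊤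

open scoped MatrixOrder Matrix.Norms.L2Operator CStarAlgebra in
/-- A linear map on `d × d` matrices is a quantum channel if it is completely positive and
trace preserving. -/
def IsQuantumChannel {d : ℕ}
    (T : Matrix (Fin d) (Fin d) ℂ →ₗ[ℂ] Matrix (Fin d) (Fin d) ℂ) : Prop :=
  (∃ Φ : Matrix (Fin d) (Fin d) ℂ →CP Matrix (Fin d) (Fin d) ℂ, ∀ A, Φ A = T A) ∧
    ∀ A, (T A).trace = A.trace

/-!
By Loewner's integral representation of real powers, `χ²_α(ρ, σ)` is the average over weights
`w = (w₁, w₂)` of the quadratic forms `⟨X, (w₁ L_σ + w₂ R_σ)⁻¹ X⟩` with `X = ρ - σ`, where `L_σ` and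
`R_σ` are left and right multiplication by `σ`. Each of these forms is a supremum over matrices `Y`
of functions that are jointly linear in `(X, σ)`, hence jointly convex, and it is infinite exactly
when the support condition fails. If `T` is two-positive and does not increase the trace, its
adjoint satisfies a Schwarz inequality, so a competitor `Y` for `(T X, T σ)` pulls back to a
competitor for `(X, σ)` that is at least as good.
-/

open Matrix MeasureTheory Set
open scoped ENNReal ComplexOrder

section IntegralRepresentation

variable {α l m : ℝ}

theorem rpowIntegrand₀₁_div_mul_inv {t : ℝ} (hl : 0 < l) (hm : 0 < m) (ht : 0 < t) :
    Real.rpowIntegrand₀₁ (1 - α) t (l / m) * l⁻¹ = (t ^ α * l + t ^ (1 + α) * m)⁻¹ := by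
  have h_sub : t ^ (1 - α) = t * (t ^ α)⁻¹ := by
    rw [Real.rpow_sub ht, Real.rpow_one, div_eq_mul_inv]
  have h_add : t ^ (1 + α) = t * t ^ α := by rw [Real.rpow_add ht, Real.rpow_one]
  rw [Real.rpowIntegrand₀₁, h_sub, h_add]
  field_simp
  ring

theorem div_rpow_mul_inv (hl : 0 < l) (hm : 0 < m) :
    (l / m) ^ (1 - α) * l⁻¹ = l ^ (-α) * m ^ (α - 1) := by
  rw [Real.div_rpow hl.le hm.le, show α - 1 = -(1 - α) by ring, Real.rpow_neg hm.le,
    show -α = 1 - α - 1 by ring, Real.rpow_sub_one hl.ne']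
  ring

/-- `μ` represents `l ^ (-α) * m ^ (α - 1)` as an average of the functions
`(w₁ * l + w₂ * m)⁻¹` over pairs `w` of nonnegative weights that do not both vanish. -/
structure IsRepresentingMeasure (α : ℝ) (μ : Measure (ℝ × ℝ)) : Prop where
  ae_pos : ∀ᵐ w ∂μ, 0 < w
  lintegral_inv {l m : ℝ} : 0 < l → 0 < m →
    ∫⁻ w, ENNReal.ofReal (w.1 * l + w.2 * m)⁻¹ ∂μ = ENNReal.ofReal (l ^ (-α) * m ^ (α - 1))

theorem exists_isRepresentingMeasure_of_mem_Ioo (hα : α ∈ Ioo (0 : ℝ) 1) :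
    ∃ μ, IsRepresentingMeasure α μ := by
  have hα' : 1 - α ∈ Ioo (0 : ℝ) 1 := ⟨sub_pos.2 hα.2, sub_lt_self 1 hα.1⟩
  obtain ⟨ν, hν⟩ := Real.exists_measure_rpow_eq_integral_rpowIntegrand₀₁ hα'
  -- These weights absorb the density of Loewner's integral representation of `x ^ (1 - α)`.
  have hmeas : Measurable fun t : ℝ => (t ^ α, t ^ (1 + α)) := by fun_prop
  refine ⟨(ν.restrict (Ioi 0)).map fun t => (t ^ α, t ^ (1 + α)), ?_, fun {l m} hl hm => ?_⟩
  · have hset : MeasurableSet {w : ℝ × ℝ | 0 < w} := by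
      simp only [lt_iff_le_and_ne, ne_comm (a := (0 : ℝ × ℝ))]
      exact measurableSet_Ici.inter (measurableSet_singleton 0).compl
    rw [ae_map_iff hmeas.aemeasurable hset]
    filter_upwards [ae_restrict_mem measurableSet_Ioi] with t ht
    exact Prod.mk_lt_mk_of_lt_of_le (Real.rpow_pos_of_pos ht _) (Real.rpow_nonneg ht.le _)
  · have hpos : 0 ≤ l / m := (div_pos hl hm).le
    have hnonneg : ∀ᵐ t ∂ν.restrict (Ioi 0),
        0 ≤ Real.rpowIntegrand₀₁ (1 - α) t (l / m) * l⁻¹ := by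
      filter_upwards [ae_restrict_mem measurableSet_Ioi] with t ht
      exact mul_nonneg (Real.rpowIntegrand₀₁_nonneg hα'.1 (le_of_lt ht) hpos) (inv_nonneg.2 hl.le)
    calc ∫⁻ w : ℝ × ℝ, ENNReal.ofReal (w.1 * l + w.2 * m)⁻¹ ∂_
        = ∫⁻ t in Ioi 0, ENNReal.ofReal (t ^ α * l + t ^ (1 + α) * m)⁻¹ ∂ν :=
          lintegral_map (by fun_prop) hmeas
      _ = ∫⁻ t in Ioi 0, ENNReal.ofReal (Real.rpowIntegrand₀₁ (1 - α) t (l / m) * l⁻¹) ∂ν :=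
          setLIntegral_congr_fun measurableSet_Ioi fun t ht => by
            rw [rpowIntegrand₀₁_div_mul_inv hl hm ht]
      _ = ENNReal.ofReal (∫ t in Ioi 0, Real.rpowIntegrand₀₁ (1 - α) t (l / m) * l⁻¹ ∂ν) :=
          (ofReal_integral_eq_lintegral_ofReal ((hν _ hpos).1.mul_const _) hnonneg).symm
      _ = ENNReal.ofReal (l ^ (-α) * m ^ (α - 1)) := by
          rw [integral_mul_const, ← (hν _ hpos).2, div_rpow_mul_inv hl hm]

theorem exists_isRepresentingMeasure (hα : α ∈ Icc (0 : ℝ) 1) :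
    ∃ μ, IsRepresentingMeasure α μ := by
  rcases eq_endpoints_or_mem_Ioo_of_mem_Icc hα with rfl | rfl | hα
  · exact ⟨.dirac (0, 1), by simp [ae_dirac_eq, Prod.lt_iff],
      fun {l m} _ _ => by simp [lintegral_dirac, Real.rpow_neg_one]⟩
  · exact ⟨.dirac (1, 0), by simp [ae_dirac_eq, Prod.lt_iff],
      fun {l m} _ _ => by simp [lintegral_dirac, Real.rpow_neg_one]⟩
  · exact exists_isRepresentingMeasure_of_mem_Ioo hα

namespace IsRepresentingMeasure

variable {μ : Measure (ℝ × ℝ)}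

theorem ne_zero (hμ : IsRepresentingMeasure α μ) : μ ≠ 0 := by
  rintro rfl
  simpa using hμ.lintegral_inv one_pos one_pos

theorem lintegral_div (hμ : IsRepresentingMeasure α μ) {c : ℝ} (hc : 0 ≤ c) (hl : 0 ≤ l)
    (hm : 0 ≤ m) (h : l = 0 ∨ m = 0 → c = 0) :
    ∫⁻ w, ENNReal.ofReal (c / (w.1 * l + w.2 * m)) ∂μ =
      ENNReal.ofReal (c * (l ^ (-α) * m ^ (α - 1))) := by
  by_cases hlm : l = 0 ∨ m = 0
  · simp [h hlm]
  · push Not at hlm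
    simp only [div_eq_mul_inv, ENNReal.ofReal_mul hc]
    rw [lintegral_const_mul _ (by fun_prop),
      hμ.lintegral_inv (hl.lt_of_ne' hlm.1) (hm.lt_of_ne' hlm.2)]

end IsRepresentingMeasure

end IntegralRepresentation

section ResolventForm

variable {n : Type*} [Fintype n]

/-- The concave quadratic function of `Y` whose supremum is `⟨X, (w₁ L_σ + w₂ R_σ)⁻¹ X⟩`, where
`L_σ` and `R_σ` are left and right multiplication by `σ` and `⟨A, B⟩ = tr (Aᴴ * B)`. -/
noncomputable def resolventObjective (w : ℝ × ℝ) (X σ Y : Matrix n n ℂ) : ℝ :=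
  2 * (Yᴴ * X).trace.re - w.1 * (Yᴴ * σ * Y).trace.re - w.2 * (Y * σ * Yᴴ).trace.re

/-- The extended-valued quadratic form `⟨X, (w₁ L_σ + w₂ R_σ)⁻¹ X⟩`, defined as a supremum so that
it is `∞` where `X` does not lie in the range of `w₁ L_σ + w₂ R_σ`. -/
noncomputable def resolventForm (w : ℝ × ℝ) (X σ : Matrix n n ℂ) : ℝ≥0∞ :=
  ⨆ Y, ENNReal.ofReal (resolventObjective w X σ Y)

theorem resolventObjective_smul_add_smul (w : ℝ × ℝ) (a b : ℝ) (X₁ X₂ σ₁ σ₂ Y : Matrix n n ℂ) :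
    resolventObjective w (a • X₁ + b • X₂) (a • σ₁ + b • σ₂) Y =
      a * resolventObjective w X₁ σ₁ Y + b * resolventObjective w X₂ σ₂ Y := by
  simp only [resolventObjective, Matrix.mul_add, Matrix.add_mul, Matrix.mul_smul, Matrix.smul_mul,
    trace_add, trace_smul, Complex.add_re, Complex.real_smul, Complex.re_ofReal_mul]
  ring

theorem resolventForm_smul_add_smul_le (w : ℝ × ℝ) {a b : ℝ} (ha : 0 ≤ a) (hb : 0 ≤ b)
    (X₁ X₂ σ₁ σ₂ : Matrix n n ℂ) :
    resolventForm w (a • X₁ + b • X₂) (a • σ₁ + b • σ₂) ≤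
      ENNReal.ofReal a * resolventForm w X₁ σ₁ + ENNReal.ofReal b * resolventForm w X₂ σ₂ := by
  refine iSup_le fun Y => ?_
  rw [resolventObjective_smul_add_smul]
  refine ENNReal.ofReal_add_le.trans ?_
  rw [ENNReal.ofReal_mul ha, ENNReal.ofReal_mul hb]
  gcongr <;> exact le_iSup (fun Y => ENNReal.ofReal (resolventObjective w _ _ Y)) Y

theorem measurable_resolventForm (X σ : Matrix n n ℂ) :
    Measurable fun w => resolventForm w X σ := by
  have hcont (Y : Matrix n n ℂ) : Continuous fun w => resolventObjective w X σ Y := by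
    unfold resolventObjective
    fun_prop
  exact (lowerSemicontinuous_iSup fun Y =>
    (ENNReal.continuous_ofReal.comp (hcont Y)).lowerSemicontinuous).measurable

theorem lintegral_resolventForm_smul_add_smul_le (μ : Measure (ℝ × ℝ)) {a b : ℝ}
    (ha : 0 ≤ a) (hb : 0 ≤ b) (X₁ X₂ σ₁ σ₂ : Matrix n n ℂ) :
    ∫⁻ w, resolventForm w (a • X₁ + b • X₂) (a • σ₁ + b • σ₂) ∂μ ≤
      ENNReal.ofReal a * ∫⁻ w, resolventForm w X₁ σ₁ ∂μ +
        ENNReal.ofReal b * ∫⁻ w, resolventForm w X₂ σ₂ ∂μ := by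
  have h₁ := measurable_resolventForm X₁ σ₁
  have h₂ := measurable_resolventForm X₂ σ₂
  rw [← lintegral_const_mul _ h₁, ← lintegral_const_mul _ h₂, ← lintegral_add_left (h₁.const_mul _)]
  exact lintegral_mono fun w => resolventForm_smul_add_smul_le w ha hb X₁ X₂ σ₁ σ₂

end ResolventForm

section TwoPositive

variable {m n : Type*}

/-- Two-positivity of a linear map of matrices: applied entrywise to `2 × 2` block matrices, the
map preserves positive semidefiniteness. -/
def IsTwoPositive (T : Matrix m m ℂ →ₗ[ℂ] Matrix n n ℂ) : Prop :=
  ∀ A B C D, (fromBlocks A B C D).PosSemidef → (fromBlocks (T A) (T B) (T C) (T D)).PosSemidef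

theorem posSemidef_fromBlocks_mul [Fintype m] [Finite n] {A : Matrix m m ℂ} (hA : A.PosSemidef)
    (B : Matrix m n ℂ) : (fromBlocks A (A * B) (Bᴴ * A) (Bᴴ * A * B)).PosSemidef := by
  classical
  have h := hA.conjTranspose_mul_mul_same (fromCols (1 : Matrix m m ℂ) B)
  rwa [conjTranspose_fromCols_eq_fromRows_conjTranspose, conjTranspose_one, fromRows_mul,
    Matrix.one_mul, fromRows_mul_fromCols, Matrix.mul_one, Matrix.mul_one] at h

variable {T : Matrix m m ℂ →ₗ[ℂ] Matrix n n ℂ}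

theorem IsTwoPositive.map_posSemidef [Finite m] (hT : IsTwoPositive T) {A : Matrix m m ℂ}
    (hA : A.PosSemidef) : (T A).PosSemidef := by
  cases nonempty_fintype m
  exact (hT _ _ _ _ (posSemidef_fromBlocks_mul hA 0)).submatrix Sum.inl

theorem IsTwoPositive.map_conjTranspose [Finite m] (hT : IsTwoPositive T) (A : Matrix m m ℂ) :
    T Aᴴ = (T A)ᴴ := by
  classical
  cases nonempty_fintype m
  have h := hT _ _ _ _ (posSemidef_fromBlocks_mul PosSemidef.one A)
  simpa using (isHermitian_fromBlocks_iff.1 h.1).2.1.symm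

variable [DecidableEq m] [Fintype n]

/-- The adjoint of a linear map of matrices with respect to the bilinear form `tr (A * B)`. -/
def traceAdjoint {R : Type*} [CommSemiring R]
    (T : Matrix m m R →ₗ[R] Matrix n n R) (Y : Matrix n n R) : Matrix m m R :=
  of fun i j => (Y * T (Matrix.single j i 1)).trace

theorem trace_traceAdjoint_mul [Fintype m] {R : Type*} [CommSemiring R]
    (T : Matrix m m R →ₗ[R] Matrix n n R) (Y : Matrix n n R) (A : Matrix m m R) :
    (traceAdjoint T Y * A).trace = (Y * T A).trace := by
  have h_single (i j : m) : Matrix.single i j (A i j) = A i j • Matrix.single i j (1 : R) := by simp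
  conv_rhs => rw [matrix_eq_sum_single A]
  simp only [h_single, map_sum, map_smul, Finset.mul_sum, trace_sum, Matrix.mul_smul, trace_smul]
  rw [Finset.sum_comm]
  simp [trace, mul_apply (N := A), traceAdjoint, mul_comm]

namespace IsTwoPositive

theorem traceAdjoint_conjTranspose [Finite m] (hT : IsTwoPositive T) (Y : Matrix n n ℂ) :
    traceAdjoint T Yᴴ = (traceAdjoint T Y)ᴴ := by
  ext i j
  simp only [traceAdjoint, of_apply, conjTranspose_apply]
  rw [← trace_conjTranspose, conjTranspose_mul, ← hT.map_conjTranspose, conjTranspose_single,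
    star_one, trace_mul_comm]

variable [Fintype m]

-- A Schwarz inequality for the adjoint, from testing the block positivity on the column `(Y, -1)`.
theorem trace_traceAdjoint_mul_mul_le (hT : IsTwoPositive T)
    (htr : ∀ A, A.PosSemidef → (T A).trace ≤ A.trace) {σ : Matrix m m ℂ} (hσ : σ.PosSemidef)
    (Y : Matrix n n ℂ) :
    ((traceAdjoint T Y)ᴴ * σ * traceAdjoint T Y).trace ≤ (Yᴴ * T σ * Y).trace := by
  classical
  set Z := traceAdjoint T Y
  have hpos := ((hT _ _ _ _ (posSemidef_fromBlocks_mul hσ Z)).conjTranspose_mul_mul_same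
    (fromRows Y (-1 : Matrix n n ℂ))).trace_nonneg
  have hcross : (Yᴴ * T (σ * Z)).trace = (Zᴴ * σ * Z).trace := by
    rw [← trace_traceAdjoint_mul, hT.traceAdjoint_conjTranspose, Matrix.mul_assoc]
  have hcross' : (T (Zᴴ * σ) * Y).trace = (Zᴴ * σ * Z).trace := by
    rw [trace_mul_comm, ← trace_traceAdjoint_mul, trace_mul_comm]
  have hexpand : (fromRows Y (-1 : Matrix n n ℂ))ᴴ *
      fromBlocks (T σ) (T (σ * Z)) (T (Zᴴ * σ)) (T (Zᴴ * σ * Z)) * fromRows Y (-1 : Matrix n n ℂ) =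
      Yᴴ * T σ * Y - Yᴴ * T (σ * Z) - T (Zᴴ * σ) * Y + T (Zᴴ * σ * Z) := by
    rw [conjTranspose_fromRows_eq_fromCols_conjTranspose, fromCols_mul_fromBlocks,
      fromCols_mul_fromRows, conjTranspose_neg, conjTranspose_one]
    noncomm_ring
  rw [hexpand, trace_add, trace_sub, trace_sub, hcross, hcross'] at hpos
  have hle := htr _ (hσ.conjTranspose_mul_mul_same Z)
  calc (Zᴴ * σ * Z).trace
      ≤ (Zᴴ * σ * Z).trace + ((Yᴴ * T σ * Y).trace - (Zᴴ * σ * Z).trace - (Zᴴ * σ * Z).trace +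
          (T (Zᴴ * σ * Z)).trace) := le_add_of_nonneg_right hpos
    _ ≤ (Zᴴ * σ * Z).trace + ((Yᴴ * T σ * Y).trace - (Zᴴ * σ * Z).trace - (Zᴴ * σ * Z).trace +
          (Zᴴ * σ * Z).trace) := by gcongr
    _ = (Yᴴ * T σ * Y).trace := by ring

theorem resolventObjective_map_le (hT : IsTwoPositive T)
    (htr : ∀ A, A.PosSemidef → (T A).trace ≤ A.trace) {σ : Matrix m m ℂ} (hσ : σ.PosSemidef)
    {w : ℝ × ℝ} (hw : 0 ≤ w) (X : Matrix m m ℂ) (Y : Matrix n n ℂ) :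
    resolventObjective w (T X) (T σ) Y ≤ resolventObjective w X σ (traceAdjoint T Y) := by
  have hleft := mul_le_mul_of_nonneg_left
    (Complex.re_le_re (hT.trace_traceAdjoint_mul_mul_le htr hσ Y)) hw.1
  have hright := mul_le_mul_of_nonneg_left
    (Complex.re_le_re (hT.trace_traceAdjoint_mul_mul_le htr hσ Yᴴ)) hw.2
  rw [hT.traceAdjoint_conjTranspose, conjTranspose_conjTranspose,
    conjTranspose_conjTranspose] at hright
  rw [resolventObjective, resolventObjective, ← hT.traceAdjoint_conjTranspose,
    trace_traceAdjoint_mul, hT.traceAdjoint_conjTranspose]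
  linarith

end IsTwoPositive

end TwoPositive

theorem IsTwoPositive.resolventForm_map_le {m n : Type*} [Fintype m] [Fintype n]
    {T : Matrix m m ℂ →ₗ[ℂ] Matrix n n ℂ} (hT : IsTwoPositive T)
    (htr : ∀ A, A.PosSemidef → (T A).trace ≤ A.trace) {σ : Matrix m m ℂ} (hσ : σ.PosSemidef)
    {w : ℝ × ℝ} (hw : 0 ≤ w) (X : Matrix m m ℂ) :
    resolventForm w (T X) (T σ) ≤ resolventForm w X σ := by
  classical
  exact iSup_le fun Y => le_iSup_of_le (traceAdjoint T Y)
    (ENNReal.ofReal_le_ofReal (hT.resolventObjective_map_le htr hσ hw X Y))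

section CompletelyPositive

open scoped MatrixOrder Matrix.Norms.L2Operator CStarAlgebra

-- Stated for a variable algebra because instance search does not find the functional calculus that
-- `CStarAlgebra.nonneg_iff_eq_star_mul_self` needs on `CStarMatrix`.
theorem exists_eq_star_mul_self_of_nonneg {A : Type*} [NonUnitalCStarAlgebra A] [PartialOrder A]
    [StarOrderedRing A] {a : A} (ha : 0 ≤ a) : ∃ s, a = star s * s :=
  CStarAlgebra.nonneg_iff_eq_star_mul_self.1 ha

theorem exists_completelyPositiveMap_sum_eq {A₁ A₂ : Type*} [NonUnitalCStarAlgebra A₁]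
    [NonUnitalCStarAlgebra A₂] [PartialOrder A₁] [PartialOrder A₂] [StarOrderedRing A₁]
    [StarOrderedRing A₂] {k : Type*} [Fintype k] (Φ : A₁ →CP A₂) (N : k → k → A₁) :
    ∃ S : k → k → A₂, ∀ i j, Φ (∑ l, star (N l i) * N l j) = ∑ l, star (S l i) * S l j := by
  have h := Φ.map_cstarMatrix_nonneg _ (star_mul_self_nonneg (CStarMatrix.ofMatrix (of N)))
  obtain ⟨S, hS⟩ := exists_eq_star_mul_self_of_nonneg h
  exact ⟨S, fun i j => congrFun (congrFun hS i) j⟩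

theorem isTwoPositive_completelyPositiveMap {m n : Type*} [Fintype m] [DecidableEq m] [Fintype n]
    [DecidableEq n] (Φ : Matrix m m ℂ →CP Matrix n n ℂ) :
    IsTwoPositive Φ.toLinearMap := by
  intro A B C D h
  obtain ⟨K, hK⟩ := CStarAlgebra.nonneg_iff_eq_star_mul_self.1 h.nonneg
  rw [star_eq_conjTranspose, ← fromBlocks_toBlocks K, fromBlocks_conjTranspose,
    fromBlocks_multiply, fromBlocks_inj] at hK
  obtain ⟨rfl, rfl, rfl, rfl⟩ := hK
  obtain ⟨S, hS⟩ := exists_completelyPositiveMap_sum_eq Φ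
    !![K.toBlocks₁₁, K.toBlocks₁₂; K.toBlocks₂₁, K.toBlocks₂₂]
  have hmap := posSemidef_conjTranspose_mul_self
    (fromBlocks (S 0 0) (S 0 1) (S 1 0) (S 1 1))
  rw [fromBlocks_conjTranspose, fromBlocks_multiply] at hmap
  simp only [Fin.sum_univ_two, Fin.forall_fin_two, star_eq_conjTranspose] at hS
  obtain ⟨⟨h₀₀, h₀₁⟩, h₁₀, h₁₁⟩ := hS
  rwa [← h₀₀, ← h₀₁, ← h₁₀, ← h₁₁] at hmap

end CompletelyPositive

open scoped MatrixOrder Matrix.Norms.L2Operator CStarAlgebra in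
theorem IsQuantumChannel.isTwoPositive {d : ℕ}
    {T : Matrix (Fin d) (Fin d) ℂ →ₗ[ℂ] Matrix (Fin d) (Fin d) ℂ} (hT : IsQuantumChannel T) :
    IsTwoPositive T := by
  obtain ⟨⟨Φ, hΦ⟩, -⟩ := hT
  rw [← show Φ.toLinearMap = T from LinearMap.ext hΦ]
  exact isTwoPositive_completelyPositiveMap Φ

section KernelEntries

variable {n : Type*}

theorem diagonal_dvd_iff [Fintype n] [DecidableEq n] {K : Type*} [DivisionRing K] {d : n → K}
    {A : Matrix n n K} : diagonal d ∣ A ↔ ∀ i j, d i = 0 → A i j = 0 := by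
  constructor
  · rintro ⟨B, rfl⟩ i j hi
    rw [diagonal_mul, hi, zero_mul]
  · intro h
    refine ⟨of fun i j => (d i)⁻¹ * A i j, ?_⟩
    ext i j
    rw [diagonal_mul, of_apply]
    by_cases hi : d i = 0
    · rw [h i j hi, hi, zero_mul]
    · rw [mul_inv_cancel_left₀ hi]

theorem posSemidef_apply_eq_zero_of_diag_eq_zero [Finite n] {𝕜 : Type*} [RCLike 𝕜]
    {A : Matrix n n 𝕜} (hA : A.PosSemidef) {i : n} (hi : A i i = 0) (j : n) : A i j = 0 := by
  classical
  cases nonempty_fintype n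
  have hcol : A *ᵥ Pi.single i 1 = 0 := by
    rw [← hA.dotProduct_mulVec_zero_iff, mulVec_single_one, ← Pi.single_star, single_dotProduct]
    simp [hi]
  have hji : A j i = 0 := by simpa using congrFun hcol j
  rw [← hA.1.apply i j, hji, star_zero]

end KernelEntries

section CompletingTheSquare

theorem two_mul_re_star_mul_sub_le {c : ℝ} (hc : 0 ≤ c) {x : ℂ} (hx : c = 0 → x = 0) (y : ℂ) :
    2 * (star y * x).re - c * Complex.normSq y ≤ Complex.normSq x / c := by
  rcases hc.eq_or_lt with rfl | hc
  · simp [hx rfl]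
  · rw [le_div_iff₀ hc]
    simp only [RCLike.star_def, Complex.mul_re, Complex.conj_re, Complex.conj_im,
      Complex.normSq_apply]
    linarith [sq_nonneg (c * y.re - x.re), sq_nonneg (c * y.im - x.im)]

theorem two_mul_re_star_div_mul_sub (c : ℝ) (x : ℂ) :
    2 * (star (x / c) * x).re - c * Complex.normSq (x / c) = Complex.normSq x / c := by
  rcases eq_or_ne c 0 with rfl | hc
  · simp
  · have hcross : (star (x / c) * x).re = Complex.normSq x / c := by
      rw [star_div₀, div_mul_eq_mul_div, RCLike.star_def, Complex.conj_ofReal,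
        ← Complex.normSq_eq_conj_mul_self, ← Complex.ofReal_div, Complex.ofReal_re]
    rw [hcross, Complex.normSq_div, Complex.normSq_ofReal]
    field_simp
    ring

theorem eq_zero_or_eq_zero_of_weighted_sum_eq_zero {w : ℝ × ℝ} (hw : 0 < w) {l m : ℝ} (hl : 0 ≤ l)
    (hm : 0 ≤ m) (h : w.1 * l + w.2 * m = 0) : l = 0 ∨ m = 0 := by
  rw [add_eq_zero_iff_of_nonneg (mul_nonneg hw.le.1 hl) (mul_nonneg hw.le.2 hm), mul_eq_zero,
    mul_eq_zero] at h
  by_contra! hlm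
  exact hw.ne' (Prod.ext (h.1.resolve_right hlm.1) (h.2.resolve_right hlm.2))

end CompletingTheSquare

section EigenCoords

variable {n : Type*} [Fintype n] [DecidableEq n] {σ : Matrix n n ℂ}

section IsHermitian

variable (hσ : σ.IsHermitian)

/-- The matrix entries of the operator `X` in an orthonormal eigenbasis of the Hermitian
matrix `σ`. -/
noncomputable def eigenCoords : Matrix n n ℂ ≃⋆ₐ[ℂ] Matrix n n ℂ :=
  (Unitary.conjStarAlgAut ℂ _ hσ.eigenvectorUnitary).symm

theorem eigenCoords_self : eigenCoords hσ σ = diagonal (fun i => (hσ.eigenvalues i : ℂ)) := by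
  rw [eigenCoords, StarAlgEquiv.symm_apply_eq]
  exact hσ.spectral_theorem

theorem trace_eigenCoords (X : Matrix n n ℂ) : (eigenCoords hσ X).trace = X.trace := by
  rw [eigenCoords, Unitary.conjStarAlgAut_symm_apply, trace_mul_cycle]
  simp

theorem conjTranspose_eigenCoords (X : Matrix n n ℂ) : (eigenCoords hσ X)ᴴ = eigenCoords hσ Xᴴ :=
  (map_star (eigenCoords hσ) X).symm

theorem posSemidef_eigenCoords {X : Matrix n n ℂ} (hX : X.PosSemidef) :
    (eigenCoords hσ X).PosSemidef := by
  rw [eigenCoords, Unitary.conjStarAlgAut_symm_apply]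
  exact hX.conjTranspose_mul_mul_same _

theorem resolventObjective_eq_sum_eigenCoords (w : ℝ × ℝ) (X Y : Matrix n n ℂ) :
    resolventObjective w X σ Y = ∑ i, ∑ j,
      (2 * (star (eigenCoords hσ Y i j) * eigenCoords hσ X i j).re -
        (w.1 * hσ.eigenvalues i + w.2 * hσ.eigenvalues j) *
          Complex.normSq (eigenCoords hσ Y i j)) := by
  have hlin : (Yᴴ * X).trace.re =
      ∑ i, ∑ j, (star (eigenCoords hσ Y i j) * eigenCoords hσ X i j).re := by
    rw [← trace_eigenCoords hσ, map_mul, ← conjTranspose_eigenCoords, Finset.sum_comm]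
    simp [trace, mul_apply]
  have hleft : (Yᴴ * σ * Y).trace.re =
      ∑ i, ∑ j, hσ.eigenvalues i * Complex.normSq (eigenCoords hσ Y i j) := by
    rw [trace_mul_comm, ← Matrix.mul_assoc, ← trace_eigenCoords hσ, map_mul, map_mul,
      ← conjTranspose_eigenCoords, eigenCoords_self]
    simp [trace, mul_apply (N := _ᴴ), Complex.normSq_apply, Finset.mul_sum, mul_comm]
  have hright : (Y * σ * Yᴴ).trace.re =
      ∑ i, ∑ j, hσ.eigenvalues j * Complex.normSq (eigenCoords hσ Y i j) := by
    rw [← trace_eigenCoords hσ, map_mul, map_mul, ← conjTranspose_eigenCoords, eigenCoords_self]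
    simp only [trace, diag_apply, mul_apply (N := _ᴴ), mul_diagonal, Complex.re_sum]
    refine Finset.sum_congr rfl fun i _ => Finset.sum_congr rfl fun j _ => ?_
    simp only [conjTranspose_apply, RCLike.star_def, Complex.mul_re, Complex.ofReal_re,
      Complex.ofReal_im, mul_zero, sub_zero, Complex.conj_re, Complex.mul_im, zero_add,
      Complex.conj_im, mul_neg, sub_neg_eq_add, Complex.normSq_apply]
    ring
  rw [resolventObjective, hlin, hleft, hright]
  simp only [Finset.mul_sum, ← Finset.sum_sub_distrib]
  congr! 2
  ring

theorem dvd_iff_eigenCoords_eq_zero {X : Matrix n n ℂ} :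
    σ ∣ X ↔ ∀ i j, hσ.eigenvalues i = 0 → eigenCoords hσ X i j = 0 := by
  rw [← map_dvd_iff (eigenCoords hσ), eigenCoords_self, diagonal_dvd_iff]
  simp only [Complex.ofReal_eq_zero]

theorem eigenCoords_eq_zero_of_dvd {X : Matrix n n ℂ} (hX : X.IsHermitian) (h : σ ∣ X) {i j : n}
    (hij : hσ.eigenvalues i = 0 ∨ hσ.eigenvalues j = 0) :
    eigenCoords hσ X i j = 0 := by
  rw [dvd_iff_eigenCoords_eq_zero hσ] at h
  rcases hij with hi | hj
  · exact h i j hi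
  · have hX' : (eigenCoords hσ X).IsHermitian := by
      rw [IsHermitian, conjTranspose_eigenCoords, hX]
    rw [← hX'.apply i j, h j i hj, star_zero]

theorem exists_eigenCoords_diag_pos {ρ : Matrix n n ℂ} (hρ : ρ.PosSemidef) (h : ¬ σ ∣ ρ) :
    ∃ i, hσ.eigenvalues i = 0 ∧ 0 < eigenCoords hσ ρ i i := by
  rw [dvd_iff_eigenCoords_eq_zero hσ] at h
  push Not at h
  obtain ⟨i, j, hi, hij⟩ := h
  have hρ' := posSemidef_eigenCoords hσ hρ
  exact ⟨i, hi, hρ'.diag_nonneg.lt_of_ne' fun h₀ =>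
    hij (posSemidef_apply_eq_zero_of_diag_eq_zero hρ' h₀ j)⟩

-- Competitors on the kernel of `σ` have no quadratic cost.
theorem resolventForm_eq_top_of_eigenCoords_diag_pos {X : Matrix n n ℂ} {i : n}
    (hi : hσ.eigenvalues i = 0) (hX : 0 < eigenCoords hσ X i i) (w : ℝ × ℝ) :
    resolventForm w X σ = ⊤ := by
  have hre : 0 < (eigenCoords hσ X i i).re := (Complex.lt_def.1 hX).1
  have hobj (c : ℝ) :
      resolventObjective w X σ ((eigenCoords hσ).symm (Matrix.single i i (c : ℂ))) =
        2 * c * (eigenCoords hσ X i i).re := by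
    rw [resolventObjective_eq_sum_eigenCoords hσ, Finset.sum_eq_single i,
      Finset.sum_eq_single i] <;>
      simp +contextual [Matrix.single_apply, hi, mul_assoc, eq_comm]
  refine ENNReal.eq_top_of_forall_nnreal_le fun r => le_iSup_of_le ((eigenCoords hσ).symm
    (Matrix.single i i ((r / (2 * (eigenCoords hσ X i i).re) : ℝ) : ℂ))) ?_
  rw [hobj, mul_right_comm, mul_div_cancel₀ _ (by positivity), ENNReal.ofReal_coe_nnreal]

end IsHermitian

open scoped MatrixOrder in
theorem eigenCoords_rpow (hσ : σ.PosSemidef) (s : ℝ) :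
    eigenCoords hσ.1 (CFC.rpow σ s) = diagonal fun i => ((hσ.1.eigenvalues i ^ s : ℝ) : ℂ) := by
  have hcfc : CFC.rpow σ s = hσ.1.cfc (fun x => x ^ s) := by
    rw [← hσ.1.cfc_eq]
    exact CFC.rpow_eq_cfc_real hσ.nonneg
  rw [hcfc, IsHermitian.cfc]
  exact StarAlgEquiv.symm_apply_apply _ _

theorem resolventForm_eq_sum (hσ : σ.PosSemidef) {X : Matrix n n ℂ} (hX : X.IsHermitian)
    (h : σ ∣ X) {w : ℝ × ℝ} (hw : 0 < w) :
    resolventForm w X σ = ∑ i, ∑ j, ENNReal.ofReal (Complex.normSq (eigenCoords hσ.1 X i j) /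
      (w.1 * hσ.1.eigenvalues i + w.2 * hσ.1.eigenvalues j)) := by
  have hden (i j : n) : 0 ≤ w.1 * hσ.1.eigenvalues i + w.2 * hσ.1.eigenvalues j :=
    add_nonneg (mul_nonneg hw.le.1 (hσ.eigenvalues_nonneg i))
      (mul_nonneg hw.le.2 (hσ.eigenvalues_nonneg j))
  have hterm (i j : n) : 0 ≤ Complex.normSq (eigenCoords hσ.1 X i j) /
      (w.1 * hσ.1.eigenvalues i + w.2 * hσ.1.eigenvalues j) :=
    div_nonneg (Complex.normSq_nonneg _) (hden i j)
  simp only [← ENNReal.ofReal_sum_of_nonneg fun j _ => hterm _ j]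
  rw [← ENNReal.ofReal_sum_of_nonneg fun i _ => Finset.sum_nonneg fun j _ => hterm i j]
  refine le_antisymm (iSup_le fun Y => ENNReal.ofReal_le_ofReal ?_) ?_
  · rw [resolventObjective_eq_sum_eigenCoords hσ.1]
    exact Finset.sum_le_sum fun i _ => Finset.sum_le_sum fun j _ =>
      two_mul_re_star_mul_sub_le (hden i j) (fun hc => eigenCoords_eq_zero_of_dvd hσ.1 hX h
        (eq_zero_or_eq_zero_of_weighted_sum_eq_zero hw (hσ.eigenvalues_nonneg i)
          (hσ.eigenvalues_nonneg j) hc)) _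
  · refine le_iSup_of_le ((eigenCoords hσ.1).symm (of fun i j => eigenCoords hσ.1 X i j /
      ((w.1 * hσ.1.eigenvalues i + w.2 * hσ.1.eigenvalues j : ℝ) : ℂ))) ?_
    rw [resolventObjective_eq_sum_eigenCoords hσ.1, StarAlgEquiv.apply_symm_apply]
    simp only [of_apply, two_mul_re_star_div_mul_sub, le_refl]

end EigenCoords

theorem resolventForm_sub_eq_top {n : Type*} [Fintype n] {ρ σ : Matrix n n ℂ}
    (hρ : ρ.PosSemidef) (hσ : σ.IsHermitian) (h : ¬ σ ∣ ρ) (w : ℝ × ℝ) :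
    resolventForm w (ρ - σ) σ = ⊤ := by
  classical
  obtain ⟨i, hi, hpos⟩ := exists_eigenCoords_diag_pos hσ hρ h
  refine resolventForm_eq_top_of_eigenCoords_diag_pos hσ hi ?_ w
  rwa [map_sub, eigenCoords_self, Matrix.sub_apply, diagonal_apply_eq, hi, Complex.ofReal_zero,
    sub_zero]

section ChiSq

variable {d : ℕ} {α : ℝ} {ρ σ : Matrix (Fin d) (Fin d) ℂ}

theorem matrixSupport_le_iff_dvd : matrixSupport ρ ≤ matrixSupport σ ↔ σ ∣ ρ := by
  constructor
  · intro h
    have hcol (j : Fin d) : ∃ w, σ *ᵥ w = ρ *ᵥ Pi.single j 1 := h ⟨Pi.single j 1, rfl⟩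
    choose W hW using hcol
    refine ⟨of fun i j => W j i, ?_⟩
    ext i j
    have hij := congrFun (hW j) i
    rw [mulVec_single_one] at hij
    exact hij.symm
  · rintro ⟨W, rfl⟩ _ ⟨x, rfl⟩
    exact ⟨W *ᵥ x, by simp⟩

theorem chiSqTrace_re_eq_sum (hρ : ρ.IsHermitian) (hσ : σ.PosSemidef) :
    (chiSqTrace α ρ σ).re = ∑ i, ∑ j, Complex.normSq (eigenCoords hσ.1 (ρ - σ) i j) *
      (hσ.1.eigenvalues i ^ (-α) * hσ.1.eigenvalues j ^ (α - 1)) := by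
  have hX : (eigenCoords hσ.1 (ρ - σ)).IsHermitian := by
    rw [IsHermitian, conjTranspose_eigenCoords, hρ.sub hσ.1]
  rw [chiSqTrace, ← trace_eigenCoords hσ.1, map_mul, map_mul, map_mul, eigenCoords_rpow hσ,
    eigenCoords_rpow hσ, Finset.sum_comm]
  simp only [trace, diag_apply, mul_diagonal, mul_apply (N := eigenCoords _ _), Finset.sum_mul,
    Complex.re_sum]
  refine Finset.sum_congr rfl fun i _ => Finset.sum_congr rfl fun j _ => ?_
  rw [← hX.apply i j]
  simp only [RCLike.star_def, Complex.mul_re, Complex.conj_re, Complex.ofReal_re, Complex.conj_im,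
    Complex.ofReal_im, mul_zero, sub_zero, Complex.mul_im, zero_add, Complex.normSq_apply]
  ring

theorem normSq_eigenCoords_mul_rpow_nonneg (hσ : σ.PosSemidef) (X : Matrix (Fin d) (Fin d) ℂ)
    (s t : ℝ) (i j : Fin d) :
    0 ≤ Complex.normSq (eigenCoords hσ.1 X i j) *
      (hσ.1.eigenvalues i ^ s * hσ.1.eigenvalues j ^ t) :=
  mul_nonneg (Complex.normSq_nonneg _) (mul_nonneg (Real.rpow_nonneg (hσ.eigenvalues_nonneg i) _)
    (Real.rpow_nonneg (hσ.eigenvalues_nonneg j) _))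

theorem chiSqTrace_re_nonneg (hρ : ρ.IsHermitian) (hσ : σ.PosSemidef) :
    0 ≤ (chiSqTrace α ρ σ).re := by
  rw [chiSqTrace_re_eq_sum hρ hσ]
  exact Finset.sum_nonneg fun i _ => Finset.sum_nonneg fun j _ =>
    normSq_eigenCoords_mul_rpow_nonneg hσ _ _ _ i j

namespace IsRepresentingMeasure

variable {μ : Measure (ℝ × ℝ)}

theorem lintegral_resolventForm (hμ : IsRepresentingMeasure α μ) (hρ : ρ.IsHermitian)
    (hσ : σ.PosSemidef) (h : σ ∣ ρ) :
    ∫⁻ w, resolventForm w (ρ - σ) σ ∂μ = ENNReal.ofReal (chiSqTrace α ρ σ).re := by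
  have hX : (ρ - σ).IsHermitian := hρ.sub hσ.1
  have hdvd : σ ∣ ρ - σ := dvd_sub_self_right.2 h
  have hterm := normSq_eigenCoords_mul_rpow_nonneg hσ (ρ - σ) (-α) (α - 1)
  rw [lintegral_congr_ae (hμ.ae_pos.mono fun w hw => resolventForm_eq_sum hσ hX hdvd hw),
    lintegral_finsetSum _ (by fun_prop), chiSqTrace_re_eq_sum hρ hσ,
    ENNReal.ofReal_sum_of_nonneg fun i _ => Finset.sum_nonneg fun j _ => hterm i j]
  refine Finset.sum_congr rfl fun i _ => ?_
  rw [lintegral_finsetSum _ (by fun_prop), ENNReal.ofReal_sum_of_nonneg fun j _ => hterm i j]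
  exact Finset.sum_congr rfl fun j _ => hμ.lintegral_div (Complex.normSq_nonneg _)
    (hσ.eigenvalues_nonneg i) (hσ.eigenvalues_nonneg j) fun hij => by
      rw [eigenCoords_eq_zero_of_dvd hσ.1 hX hdvd hij, map_zero]

theorem chiSq_eq (hμ : IsRepresentingMeasure α μ) (hρ : ρ.PosSemidef) (hσ : σ.PosSemidef) :
    chiSq α ρ σ = ((∫⁻ w, resolventForm w (ρ - σ) σ ∂μ : ℝ≥0∞) : EReal) := by
  rw [chiSq, matrixSupport_le_iff_dvd]
  split_ifs with h
  · rw [hμ.lintegral_resolventForm hρ.1 hσ h, EReal.coe_ennreal_ofReal,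
      max_eq_left (chiSqTrace_re_nonneg hρ.1 hσ)]
  · simp [resolventForm_sub_eq_top hρ hσ.1 h, hμ.ne_zero]

end IsRepresentingMeasure

theorem chiSq_smul_add_smul_le (hα : α ∈ Icc (0 : ℝ) 1)
    {ρ₁ σ₁ ρ₂ σ₂ : Matrix (Fin d) (Fin d) ℂ} (hρ₁ : ρ₁.PosSemidef) (hσ₁ : σ₁.PosSemidef)
    (hρ₂ : ρ₂.PosSemidef) (hσ₂ : σ₂.PosSemidef) {a b : ℝ} (ha : 0 ≤ a) (hb : 0 ≤ b) :
    chiSq α (a • ρ₁ + b • ρ₂) (a • σ₁ + b • σ₂) ≤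
      (a : EReal) * chiSq α ρ₁ σ₁ + (b : EReal) * chiSq α ρ₂ σ₂ := by
  obtain ⟨μ, hμ⟩ := exists_isRepresentingMeasure hα
  have hsub : a • ρ₁ + b • ρ₂ - (a • σ₁ + b • σ₂) = a • (ρ₁ - σ₁) + b • (ρ₂ - σ₂) := by module
  rw [hμ.chiSq_eq ((hρ₁.smul ha).add (hρ₂.smul hb)) ((hσ₁.smul ha).add (hσ₂.smul hb)),
    hμ.chiSq_eq hρ₁ hσ₁, hμ.chiSq_eq hρ₂ hσ₂, hsub]
  have hle := EReal.coe_ennreal_le_coe_ennreal_iff.2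
    (lintegral_resolventForm_smul_add_smul_le μ ha hb (ρ₁ - σ₁) (ρ₂ - σ₂) σ₁ σ₂)
  rwa [EReal.coe_ennreal_add, EReal.coe_ennreal_mul, EReal.coe_ennreal_mul,
    EReal.coe_ennreal_ofReal, EReal.coe_ennreal_ofReal, max_eq_left ha, max_eq_left hb] at hle

theorem chiSq_map_le (hα : α ∈ Icc (0 : ℝ) 1) {k : ℕ}
    {T : Matrix (Fin d) (Fin d) ℂ →ₗ[ℂ] Matrix (Fin k) (Fin k) ℂ} (hT : IsTwoPositive T)
    (htr : ∀ A, A.PosSemidef → (T A).trace ≤ A.trace) (hρ : ρ.PosSemidef) (hσ : σ.PosSemidef) :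
    chiSq α (T ρ) (T σ) ≤ chiSq α ρ σ := by
  obtain ⟨μ, hμ⟩ := exists_isRepresentingMeasure hα
  rw [hμ.chiSq_eq (hT.map_posSemidef hρ) (hT.map_posSemidef hσ), hμ.chiSq_eq hρ hσ, ← map_sub,
    EReal.coe_ennreal_le_coe_ennreal_iff]
  exact lintegral_mono_ae (hμ.ae_pos.mono fun w hw => hT.resolventForm_map_le htr hσ hw.le _)

end ChiSq

theorem proposition7_general {α : ℝ} (hα : α ∈ Icc (0 : ℝ) 1) :
    (∀ (d : ℕ) (ρ₁ σ₁ ρ₂ σ₂ : Matrix (Fin d) (Fin d) ℂ), ρ₁.PosSemidef → σ₁.PosSemidef →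
      ρ₂.PosSemidef → σ₂.PosSemidef → ∀ a b : ℝ, 0 ≤ a → 0 ≤ b →
        chiSq α (a • ρ₁ + b • ρ₂) (a • σ₁ + b • σ₂) ≤
          (a : EReal) * chiSq α ρ₁ σ₁ + (b : EReal) * chiSq α ρ₂ σ₂) ∧
    (∀ (d k : ℕ) (T : Matrix (Fin d) (Fin d) ℂ →ₗ[ℂ] Matrix (Fin k) (Fin k) ℂ), IsTwoPositive T →
      (∀ A, A.PosSemidef → (T A).trace ≤ A.trace) →
      ∀ ρ σ : Matrix (Fin d) (Fin d) ℂ, ρ.PosSemidef → σ.PosSemidef →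
        chiSq α (T ρ) (T σ) ≤ chiSq α ρ σ) :=
  ⟨fun _ _ _ _ _ hρ₁ hσ₁ hρ₂ hσ₂ _ _ ha hb => chiSq_smul_add_smul_le hα hρ₁ hσ₁ hρ₂ hσ₂ ha hb,
    fun _ _ _ hT htr _ _ hρ hσ => chiSq_map_le hα hT htr hρ hσ⟩

theorem proposition7 (d : ℕ) (α : ℝ) (hα : α ∈ Set.Icc (0 : ℝ) 1) :
    (∀ ρ₁ ∈ densityMatrices d, ∀ σ₁ ∈ densityMatrices d,
      ∀ ρ₂ ∈ densityMatrices d, ∀ σ₂ ∈ densityMatrices d,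
      ∀ a b : ℝ, 0 ≤ a → 0 ≤ b → a + b = 1 →
        chiSq α (a • ρ₁ + b • ρ₂) (a • σ₁ + b • σ₂) ≤
          (a : EReal) * chiSq α ρ₁ σ₁ + (b : EReal) * chiSq α ρ₂ σ₂) ∧
    (∀ T : Matrix (Fin d) (Fin d) ℂ →ₗ[ℂ] Matrix (Fin d) (Fin d) ℂ, IsQuantumChannel T →
      ∀ ρ ∈ densityMatrices d, ∀ σ ∈ densityMatrices d,
        chiSq α (T ρ) (T σ) ≤ chiSq α ρ σ) := by
  obtain ⟨hconvex, hmono⟩ := proposition7_general hα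
  exact ⟨fun _ hρ₁ _ hσ₁ _ hρ₂ _ hσ₂ a b ha hb _ =>
      hconvex d _ _ _ _ hρ₁.1 hσ₁.1 hρ₂.1 hσ₂.1 a b ha hb,
    fun _ hT _ hρ _ hσ =>
      hmono d d _ hT.isTwoPositive (fun A _ => (hT.2 A).le) _ _ hρ.1 hσ.1⟩
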